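/- Let $n\ge 0$ be an integer. Vectors $z_1,\dots,z_m\in\mathbb{R}^n$ are in linear general position if any $n$ of them (with pairwise distinct indices) are linearly independent. For $K\subseteq\mathbb{R}^n$ let $\mu(K)=\inf\{\rho>0 : \rho K+\mathbb{Z}^n=\mathbb{R}^n\}$ denote its covering radius with respect to the lattice $\mathbb{Z}^n$ (where $\inf\varnothing=\infty$). **Theorem.** Let $z_1,\dots,z_{n+1}\in\mathbb{Z}^n$ be in linear general position, and let $Z=\sum_{i=1}^{n+1}[0,z_i]\subseteq\mathbb{R}^n$ be the Minkowski sum of the segments joining $0$ to $z_i$. Then $$\mu(Z)\le\frac{n}{n+1}.$$ The vectors $z_i=e_i$ for $1\le i\le n$ (the standard unit vectors) and $z_{n+1}=\mathbf{1}_n=(1,\dots,1)$ are in linear general position, and for them $\mu(Z)=\frac{n}{n+1}$. -/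

import Mathlib

open scoped Pointwise

/-- A family of vectors of `ℝⁿ` is in linear general position if any `n` of them
(with pairwise distinct indices) are linearly independent. -/
def InLinearGeneralPosition {ι : Type*} {n : ℕ} (v : ι → Fin n → ℝ) : Prop :=
  ∀ s : Finset ι, s.card = n → LinearIndependent ℝ (fun i : s => v i)

/-- The integer lattice `ℤⁿ` inside `ℝⁿ`. -/
def integerLattice (n : ℕ) : AddSubgroup (Fin n → ℝ) :=
  ((Int.castAddHom ℝ).compLeft (Fin n)).range

/-- An integer vector, seen as a vector of `ℝⁿ`. -/
def toRealVector {n : ℕ} (z : Fin n → ℤ) : Fin n → ℝ := fun j => (z j : ℝ)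

/-- The lattice zonotope `∑ i, [0, z i]` (a Minkowski sum of segments) in `ℝⁿ`. -/
def latticeZonotope {ι : Type*} [Fintype ι] {n : ℕ} (z : ι → Fin n → ℤ) : Set (Fin n → ℝ) :=
  ∑ i, segment ℝ (0 : Fin n → ℝ) (toRealVector (z i))

/-- The covering radius `μ(K, Λ) = inf {ρ > 0 | ρ K + Λ = ℝⁿ}`. The infimum is taken in `[0, ∞]`,
so that it is `∞` (and not a junk value) if no dilate of `K` covers. -/
noncomputable def coveringRadius {n : ℕ} (K : Set (Fin n → ℝ)) (Λ : AddSubgroup (Fin n → ℝ)) :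
    ENNReal :=
  ⨅ (ρ : ℝ) (_ : 0 < ρ ∧ ρ • K + (Λ : Set (Fin n → ℝ)) = Set.univ), ENNReal.ofReal ρ

/-- The generators `e₁, …, eₙ, 1ₙ = (1, …, 1)`. -/
def unitAndAllOnes (n : ℕ) : Fin (n + 1) → Fin n → ℤ :=
  Fin.snoc (α := fun _ => Fin n → ℤ) (fun i => Pi.single i 1) (fun _ => 1)

/-! Upper bound: write `x = ∑ sᵢ zᵢ`. An integer relation `∑ vᵢ zᵢ = 0` lets `s` move to `s + t v`
without changing `x`, and integer changes of the coefficients cost only a lattice vector. So it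
suffices to find `t` with every `sᵢ + t vᵢ` in `[0, ρ]` modulo 1. General position makes all `vᵢ`
nonzero, so each `i` spoils a set of times of measure at most `1 - ρ`; a union bound
(`exists_time_forall_mem_arc`) works once `ρ > n/(n+1)`. Sharpness: for smaller `ρ` an explicit
point with evenly spaced coordinates is missed. -/

theorem mem_latticeZonotope_iff {ι : Type*} [Fintype ι] {n : ℕ} {z : ι → Fin n → ℤ}
    {x : Fin n → ℝ} :
    x ∈ latticeZonotope z ↔
      ∃ c : ι → ℝ, (∀ i, c i ∈ Set.Icc (0 : ℝ) 1) ∧ ∑ i, c i • toRealVector (z i) = x := by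
  classical
  simp only [latticeZonotope, Set.mem_fintype_sum, segment_eq_image']
  constructor
  · rintro ⟨g, hg, rfl⟩
    choose c hc hcg using hg
    refine ⟨c, hc, Finset.sum_congr rfl fun i _ => ?_⟩
    simpa using hcg i
  · rintro ⟨c, hc, rfl⟩
    exact ⟨fun i => c i • toRealVector (z i), fun i => ⟨c i, hc i, by simp⟩, rfl⟩

theorem mem_smul_latticeZonotope_iff {ι : Type*} [Fintype ι] {n : ℕ} {z : ι → Fin n → ℤ}
    {ρ : ℝ} (hρ : 0 < ρ) {x : Fin n → ℝ} :
    x ∈ ρ • latticeZonotope z ↔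
      ∃ c : ι → ℝ, (∀ i, c i ∈ Set.Icc 0 ρ) ∧ ∑ i, c i • toRealVector (z i) = x := by
  rw [Set.mem_smul_set]
  constructor
  · rintro ⟨y, hy, rfl⟩
    obtain ⟨c, hc, rfl⟩ := mem_latticeZonotope_iff.1 hy
    refine ⟨fun i => ρ * c i, fun i => ⟨mul_nonneg hρ.le (hc i).1, ?_⟩, ?_⟩
    · exact mul_le_of_le_one_right hρ.le (hc i).2
    · simp only [Finset.smul_sum, smul_smul]
  · rintro ⟨c, hc, rfl⟩
    refine ⟨_, mem_latticeZonotope_iff.2 ⟨fun i => c i / ρ, fun i => ⟨?_, ?_⟩, rfl⟩, ?_⟩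
    · exact div_nonneg (hc i).1 hρ.le
    · exact (div_le_one hρ).2 (hc i).2
    · simp only [Finset.smul_sum, smul_smul, mul_div_cancel₀ _ hρ.ne']

theorem mem_integerLattice_iff {n : ℕ} {x : Fin n → ℝ} :
    x ∈ integerLattice n ↔ ∃ a : Fin n → ℤ, toRealVector a = x :=
  Iff.rfl

/-- Points moving on a circle of length one with nonzero integer velocities are, at some common
time, all inside the closed arc `[0, ρ]`, as soon as their number times `1 - ρ` is less than one. -/
theorem exists_time_forall_mem_arc {ι : Type*} [Fintype ι] {v : ι → ℤ} (hv : ∀ i, v i ≠ 0)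
    (s : ι → ℝ) {ρ : ℝ} (hcard : (Fintype.card ι : ℝ) * (1 - ρ) < 1) :
    ∃ t : ℝ, ∀ i, ∃ a : ℤ, s i + t * v i + a ∈ Set.Icc 0 ρ := by
  by_contra! hbad
  -- The arc `[ρ, 1]`, which contains all bad positions; it is empty if `ρ > 1`.
  let B : Set UnitAddCircle := Metric.closedBall (((1 + ρ) / 2 : ℝ) : UnitAddCircle) ((1 - ρ) / 2)
  let f : ι → UnitAddCircle → UnitAddCircle := fun i t => (s i : UnitAddCircle) + v i • t
  have hf : ∀ i, MeasureTheory.MeasurePreserving (f i) := fun i =>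
    (MeasureTheory.measurePreserving_add_left _ _).comp
      (MeasureTheory.Measure.measurePreserving_zsmul _ (hv i))
  have hB : MeasureTheory.volume B ≤ ENNReal.ofReal (1 - ρ) := by
    rw [AddCircle.volume_closedBall]
    refine ENNReal.ofReal_le_ofReal ((min_le_right _ _).trans (by linarith))
  have hcover : (Set.univ : Set UnitAddCircle) ⊆ ⋃ i, f i ⁻¹' B := by
    intro t _
    induction t using QuotientAddGroup.induction_on with
    | H t =>
    obtain ⟨i, hi⟩ := hbad t
    refine Set.mem_iUnion.2 ⟨i, ?_⟩
    have h0 := Int.fract_nonneg (s i + t * v i)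
    have h1 := Int.fract_lt_one (s i + t * v i)
    have hgt : ρ < Int.fract (s i + t * v i) := by
      by_contra! hle
      refine hi (-⌊s i + t * v i⌋) ⟨?_, ?_⟩ <;> push_cast <;>
        rw [← sub_eq_add_neg, Int.self_sub_floor] <;> assumption
    have hval : f i (t : UnitAddCircle) = ((Int.fract (s i + t * v i) : ℝ) : UnitAddCircle) := by
      have : ((⌊s i + t * v i⌋ : ℝ) : UnitAddCircle) = 0 := by
        rw [AddCircle.coe_eq_zero_iff]
        exact ⟨⌊s i + t * v i⌋, by simp⟩
      rw [← Int.self_sub_floor, AddCircle.coe_sub, this, sub_zero, AddCircle.coe_add, mul_comm,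
        ← zsmul_eq_mul, AddCircle.coe_zsmul]
    change f i (t : UnitAddCircle) ∈ B
    rw [hval, Metric.mem_closedBall, dist_eq_norm, ← AddCircle.coe_sub]
    refine (QuotientAddGroup.norm_mk_le_norm (S := AddSubgroup.zmultiples (1 : ℝ))).trans ?_
    rw [Real.norm_eq_abs, abs_le]
    constructor <;> linarith
  have hle : MeasureTheory.volume (Set.univ : Set UnitAddCircle)
      ≤ ENNReal.ofReal (Fintype.card ι * (1 - ρ)) :=
    calc MeasureTheory.volume (Set.univ : Set UnitAddCircle)
        ≤ ∑ i, MeasureTheory.volume (f i ⁻¹' B) :=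
          (MeasureTheory.measure_mono hcover).trans (MeasureTheory.measure_iUnion_fintype_le _ _)
      _ ≤ ∑ _i : ι, ENNReal.ofReal (1 - ρ) := Finset.sum_le_sum fun i _ => by
          rw [(hf i).measure_preimage Metric.isClosed_closedBall.measurableSet.nullMeasurableSet]
          exact hB
      _ = ENNReal.ofReal (Fintype.card ι * (1 - ρ)) := by
          rw [Finset.sum_const, nsmul_eq_mul, Finset.card_univ,
            ENNReal.ofReal_mul (Nat.cast_nonneg _), ENNReal.ofReal_natCast]
  rw [AddCircle.measure_univ] at hle
  exact absurd hle (not_le.2 ((ENNReal.ofReal_lt_ofReal_iff one_pos).2 hcard))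

section GeneralPosition

variable {n : ℕ}

theorem InLinearGeneralPosition.eq_zero_of_sum_eq_zero {v : Fin (n + 1) → Fin n → ℝ}
    (hv : InLinearGeneralPosition v) {c : Fin (n + 1) → ℝ} (hc : ∑ i, c i • v i = 0)
    {j : Fin (n + 1)} (hj : c j = 0) : c = 0 := by
  have hli : LinearIndepOn ℝ v (Finset.univ.erase j : Finset (Fin (n + 1))) :=
    hv (Finset.univ.erase j) (by simp)
  rw [linearIndepOn_finset_iff] at hli
  funext i
  by_cases hij : i = j
  · rw [hij, hj, Pi.zero_apply]
  · refine hli c ?_ i (by simpa using hij)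
    rw [← hc, ← Finset.add_sum_erase _ _ (Finset.mem_univ j), hj, zero_smul, zero_add]

theorem inLinearGeneralPosition_iff {v : Fin (n + 1) → Fin n → ℝ} :
    InLinearGeneralPosition v ↔
      ∀ c : Fin (n + 1) → ℝ, ∑ i, c i • v i = 0 → ∀ j, c j = 0 → c = 0 := by
  refine ⟨fun hv c hc j hj => hv.eq_zero_of_sum_eq_zero hc hj, fun h s hs => ?_⟩
  change LinearIndepOn ℝ v (s : Set (Fin (n + 1)))
  rw [linearIndepOn_finset_iff]
  intro c hc i hi
  obtain ⟨j, hj⟩ : ∃ j, j ∉ s := by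
    by_contra! hall
    have := Finset.card_eq_iff_eq_univ s |>.2 (Finset.eq_univ_of_forall hall)
    simp [hs] at this
  have key := h (fun k => if k ∈ s then c k else 0) (by simpa [ite_smul] using hc) j (by simp [hj])
  simpa [hi] using congrFun key i

theorem InLinearGeneralPosition.exists_sum_smul_eq {v : Fin (n + 1) → Fin n → ℝ}
    (hv : InLinearGeneralPosition v) (x : Fin n → ℝ) : ∃ c : Fin (n + 1) → ℝ,
      ∑ i, c i • v i = x := by
  have hspan := (hv (Finset.univ.erase 0) (by simp)).span_eq_top_of_card_eq_finrank' (by simp)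
  have hx : x ∈ Submodule.span ℝ (Set.range v) := by
    refine Submodule.span_mono ?_ (hspan ▸ Submodule.mem_top : x ∈ _)
    rintro _ ⟨i, rfl⟩
    exact ⟨i, rfl⟩
  exact Submodule.mem_span_range_iff_exists_fun ℝ |>.1 hx

theorem toRealVector_sum_smul {ι : Type*} (s : Finset ι) (a : ι → ℤ) (z : ι → Fin n → ℤ) :
    toRealVector (∑ i ∈ s, a i • z i) = ∑ i ∈ s, (a i : ℝ) • toRealVector (z i) := by
  funext j
  simp [toRealVector, Finset.sum_apply]

/-- `n + 1` vectors in `ℤⁿ` are dependent over `ℤ`; by general position one zero coefficient would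
force all to vanish. -/
theorem InLinearGeneralPosition.exists_int_relation {z : Fin (n + 1) → Fin n → ℤ}
    (hz : InLinearGeneralPosition fun i => toRealVector (z i)) :
    ∃ v : Fin (n + 1) → ℤ, (∀ i, v i ≠ 0) ∧ ∑ i, (v i : ℝ) • toRealVector (z i) = 0 := by
  have hdep : ¬ LinearIndependent ℤ z := fun h => by
    simpa using h.fintype_card_le_finrank
  obtain ⟨v, hv, i, hi⟩ := Fintype.not_linearIndependent_iff.1 hdep
  have hv' : ∑ i, (v i : ℝ) • toRealVector (z i) = 0 := by
    rw [← toRealVector_sum_smul, hv]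
    funext j
    simp [toRealVector]
  refine ⟨v, fun j hj => hi ?_, hv'⟩
  have := congrFun (hz.eq_zero_of_sum_eq_zero (c := fun i => (v i : ℝ)) hv' (j := j) (by simp [hj])) i
  simpa using this

theorem smul_latticeZonotope_add_integerLattice_eq_univ {z : Fin (n + 1) → Fin n → ℤ}
    (hz : InLinearGeneralPosition fun i => toRealVector (z i)) {ρ : ℝ}
    (hρ : (n : ℝ) / (n + 1) < ρ) :
    ρ • latticeZonotope z + (integerLattice n : Set (Fin n → ℝ)) = Set.univ := by
  refine Set.eq_univ_of_forall fun x => ?_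
  have hn : (0 : ℝ) < n + 1 := by positivity
  have hρ0 : 0 < ρ := lt_of_le_of_lt (by positivity) hρ
  obtain ⟨s, rfl⟩ := hz.exists_sum_smul_eq x
  obtain ⟨v, hv0, hv⟩ := hz.exists_int_relation
  obtain ⟨t, ht⟩ := exists_time_forall_mem_arc hv0 s (by
    rw [div_lt_iff₀ hn] at hρ
    rw [Fintype.card_fin]
    push_cast
    linarith)
  choose a ha using ht
  refine Set.mem_add.2 ⟨_, (mem_smul_latticeZonotope_iff hρ0).2 ⟨_, ha, rfl⟩, _,
    mem_integerLattice_iff.2 ⟨∑ i, (-a i) • z i, rfl⟩, ?_⟩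
  have hsplit : ∀ i, (s i + t * v i + a i) • toRealVector (z i)
      = s i • toRealVector (z i) + t • ((v i : ℝ) • toRealVector (z i))
        + (a i : ℝ) • toRealVector (z i) := fun i => by module
  rw [toRealVector_sum_smul]
  simp only [hsplit, Finset.sum_add_distrib, ← Finset.smul_sum, hv, Int.cast_neg, neg_smul,
    Finset.sum_neg_distrib]
  simp

theorem coveringRadius_latticeZonotope_le {z : Fin (n + 1) → Fin n → ℤ}
    (hz : InLinearGeneralPosition fun i => toRealVector (z i)) :
    coveringRadius (latticeZonotope z) (integerLattice n)
      ≤ ENNReal.ofReal ((n : ℝ) / ((n : ℝ) + 1)) := by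
  -- Covering is known only for `ρ > n/(n+1)`, hence the limit from the right.
  have hlim : Filter.Tendsto ENNReal.ofReal (nhdsWithin ((n : ℝ) / (n + 1)) (Set.Ioi ((n : ℝ) / (n + 1))))
      (nhds (ENNReal.ofReal ((n : ℝ) / (n + 1)))) :=
    ENNReal.continuous_ofReal.continuousAt.tendsto.mono_left nhdsWithin_le_nhds
  refine ge_of_tendsto hlim ?_
  filter_upwards [self_mem_nhdsWithin] with ρ hρ
  exact iInf₂_le ρ ⟨lt_of_le_of_lt (by positivity) hρ,
    smul_latticeZonotope_add_integerLattice_eq_univ hz hρ⟩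

theorem sum_smul_unitAndAllOnes_apply (c : Fin (n + 1) → ℝ) (j : Fin n) :
    (∑ i, c i • toRealVector (unitAndAllOnes n i)) j = c j.castSucc + c (Fin.last n) := by
  simp [Finset.sum_apply, Fin.sum_univ_castSucc, unitAndAllOnes, toRealVector, Pi.single_apply]

theorem inLinearGeneralPosition_unitAndAllOnes :
    InLinearGeneralPosition fun i => toRealVector (unitAndAllOnes n i) := by
  rw [inLinearGeneralPosition_iff]
  intro c hc j hj
  have h : ∀ k : Fin n, c k.castSucc + c (Fin.last n) = 0 := fun k => by
    rw [← sum_smul_unitAndAllOnes_apply, hc, Pi.zero_apply]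
  have hlast : c (Fin.last n) = 0 := by
    induction j using Fin.lastCases with
    | last => exact hj
    | cast k => simpa [hj] using h k
  funext i
  induction i using Fin.lastCases with
  | last => exact hlast
  | cast k => simpa [hlast] using h k

theorem le_of_smul_latticeZonotope_unitAndAllOnes_covers {ρ : ℝ} (hρ : 0 < ρ)
    (hcov : ρ • latticeZonotope (unitAndAllOnes n) + (integerLattice n : Set (Fin n → ℝ))
      = Set.univ) : (n : ℝ) / (n + 1) ≤ ρ := by
  by_contra! hlt
  have hn : (0 : ℝ) < n + 1 := by positivity
  -- Put `δ = n/(n+1) - ρ > 0`. If `m`, the coefficient of `1ₙ`, lies in `[i/(n+1), (i+1)/(n+1))`,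
  -- then `xᵢ - m` modulo 1 lies in `(ρ, 1 - δ]`, out of reach of the coefficient of `eᵢ`.
  let x : Fin n → ℝ := fun i => (i : ℝ) / (n + 1) - (n / (n + 1) - ρ)
  obtain ⟨y, hy, w, hw, hyw⟩ := Set.mem_add.1 (hcov ▸ Set.mem_univ x)
  obtain ⟨c, hc, rfl⟩ := (mem_smul_latticeZonotope_iff hρ).1 hy
  obtain ⟨a, rfl⟩ := mem_integerLattice_iff.1 hw
  set m := c (Fin.last n)
  have hm : m ∈ Set.Icc 0 ρ := hc _
  have hmn : 0 ≤ m * (n + 1) := mul_nonneg hm.1 hn.le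
  -- `m ≤ ρ < n/(n+1)` rules out the last cell, so the cell of `m` indexes a coordinate.
  have hfloor : ⌊m * (n + 1)⌋₊ < n := by
    rw [Nat.floor_lt hmn]
    exact (lt_div_iff₀ hn).1 (hm.2.trans_lt hlt)
  let i : Fin n := ⟨⌊m * (n + 1)⌋₊, hfloor⟩
  have hlow : (i : ℝ) / (n + 1) ≤ m := (div_le_iff₀ hn).2 (Nat.floor_le hmn)
  have hupp : m < ((i : ℝ) + 1) / (n + 1) := (lt_div_iff₀ hn).2 (Nat.lt_floor_add_one _)
  have hone : (n : ℝ) / (n + 1) = 1 - 1 / (n + 1) := by field_simp; ring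
  have heq : c i.castSucc + m + a i = (i : ℝ) / (n + 1) - (n / (n + 1) - ρ) := by
    have := congrFun hyw i
    rwa [Pi.add_apply, sum_smul_unitAndAllOnes_apply] at this
  have hci := hc i.castSucc
  have ha : (a i : ℝ) ≤ -1 := by
    have : (a i : ℝ) < 0 := by linarith [hci.1]
    have : a i ≤ -1 := Int.le_sub_one_of_lt (by exact_mod_cast this)
    exact_mod_cast this
  rw [add_div] at hupp
  linarith [hci.2]

end GeneralPosition

theorem theorem3p6 (n : ℕ) :
    (∀ z : Fin (n + 1) → Fin n → ℤ,
      InLinearGeneralPosition (fun i => toRealVector (z i)) →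
        coveringRadius (latticeZonotope z) (integerLattice n)
          ≤ ENNReal.ofReal ((n : ℝ) / ((n : ℝ) + 1))) ∧
    InLinearGeneralPosition (fun i => toRealVector (unitAndAllOnes n i)) ∧
    coveringRadius (latticeZonotope (unitAndAllOnes n)) (integerLattice n)
      = ENNReal.ofReal ((n : ℝ) / ((n : ℝ) + 1)) :=
  ⟨fun _ hz => coveringRadius_latticeZonotope_le hz, inLinearGeneralPosition_unitAndAllOnes,
    (coveringRadius_latticeZonotope_le inLinearGeneralPosition_unitAndAllOnes).antisymm <|
      le_iInf₂ fun _ hρ => ENNReal.ofReal_le_ofReal <|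
        le_of_smul_latticeZonotope_unitAndAllOnes_covers hρ.1 hρ.2⟩
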